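/- **Conventions.** Labels are element tags (a countably infinite set $\mathbf E$), attribute names (a countably infinite set $\mathbf A$), or the text symbol $\mathtt S$; these are pairwise disjoint, and $root\in\mathbf E$ is a fixed tag. A *path* is a word $l_1.\cdots.l_n$ ($n\ge 1$) of labels with $l_1=root$; $Last(p)=l_n$, $Parnt(p)=l_1.\cdots.l_{n-1}$, and $p\cap q$ is the maximal common prefix of $p$ and $q$. An *XML tree* $T$ is a finite rooted tree with node labelling $lab$, whose root $v_r$ has label $root$. Only element-labelled nodes have children. The children of a node are its subelements (a sequence of distinct nodes without attribute labels) and its attributes (at most one for each attribute name $a\in\mathbf A$, and labelled $a$). Further, $val(v)=v$ if $lab(v)\in\mathbf E$, and $val(v)$ is a string otherwise. A *path instance over* $p=l_1.\cdots.l_n$ is a sequence $v_1.\cdots.v_n$ of nodes with $v_1=v_r$, each $v_{i+1}$ a child of $v_i$, and $lab(v_i)=l_i$; $N(p)$ is the set of final nodes of such instances, and $Nodes(x,p)$ is the set of final nodes of those instances over $p$ that contain the node $x$. Let $P$ be a set of paths. $T$ is *complete w.r.t.* $P$ if (i) whenever $l_1.\cdots.l_n$ and $p'$ are in $P$ and $l_i=Last(p')$,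 then $l_1.\cdots.l_i=p'$; (ii) whenever $v$ is the parent of $w$ in $T$, some $l_1.\cdots.l_n\in P$ and some $i<j$ satisfy $lab(v)=l_i$, $lab(w)=l_j$; and (iii) for every $p\in P$, every node of $T$ whose label occurs in $p$ lies on a path instance over $p$. An *XFD* is an expression $p_1,\dots,p_k\to q$ with paths $p_i,q$; it is *unary* if $k=1$. A tree $T$ that is complete w.r.t. $P$ *satisfies* it if $q=p_i$ for some $i$, or if for any two distinct path instances over $q$ with final nodes $v,v'$ such that $val(v)\ne val(v')$ there is an $i$ such that, with $x$ and $y$ the nodes of $N(p_i\cap q)$ on the first and on the second instance: $x\neq y$ if $Last(p_i)\in\mathbf E$, and $val(Nodes(x,p_i))\cap val(Nodes(y,p_i))=\emptyset$ if $Last(p_i)\notin\mathbf E$. **Axioms.** - A1: $p_1,\dots,p_k\to p_i$. - A2: from $p_1,\dots,p_k\to q$ infer $p,p_1,\dots,p_k\to q$. - A3: from $p_1,\dots,p_k\to q$ and $q\to s$ infer $p_1,\dots,p_k\to s$. - A4: from $p_1,\dots,p_k\to q$, where $p_i\cap q=root$ for all $i$, infer $p\to q$ for any path $p$. - A5: from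 $p\to q$ infer $p'\to q$ whenever $p\cap q$ is a prefix of $p'$ and $p'$ is a prefix of $p$ or of $q$. - A6: $p\to q$ if $Last(p)\in\mathbf E$ and $q$ is a prefix of $p$. - A7: $Parnt(q)\to q$ if $Last(q)\in\mathbf A$. - A8: $p\to root$. **Theorem (completeness of A1–A8 for unary XFDs).** Let $P$ be a set of paths for which at least one complete XML tree exists, let $\overline P$ be the set of nonempty prefixes of members of $P$, let $\Sigma$ be a set of unary XFDs whose paths all lie in $\overline P$, and let $p,q\in\overline P$. Consider derivations from $\Sigma$ by A1–A8 in which only paths of $\overline P$ occur. 1. If every XML tree that is complete w.r.t. $P$ and satisfies $\Sigma$ also satisfies $p\to q$, then $p\to q$ is derivable from $\Sigma$. 2. If $p\to q$ is not derivable from $\Sigma$, there is an XML tree that is complete w.r.t. $P$, satisfies every XFD in $\Sigma$, and violates $p\to q$. -/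

import Mathlib

/-- Labels of nodes: element tags (the countably infinite set `E`), attribute names (the
countably infinite set `A`) and the symbol `S` for text. -/
inductive Label : Type where
  | elem : ℕ → Label
  | attr : ℕ → Label
  | text : Label
  deriving DecidableEq

/-- `l ∈ E`. -/
def Label.IsElem (l : Label) : Prop := ∃ n, l = Label.elem n

/-- `l ∈ A`. -/
def Label.IsAttr (l : Label) : Prop := ∃ n, l = Label.attr n

/-- The distinguished element tag carried by the root of every tree. -/
def rootLabel : Label := Label.elem 0

/-- Words over the labels. The word `l₁.⋯.lₙ` is a path when it starts with the root label. -/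
abbrev LabelWord : Type := List Label

/-- A path is a (nonempty) word `l₁.⋯.lₙ` with `l₁ = root`. -/
def IsPath (p : LabelWord) : Prop := p.head? = some rootLabel

/-- The path consisting of the root label only. -/
def rootPath : LabelWord := [rootLabel]

/-- `Last(p) ∈ E`. -/
def LastElem (p : LabelWord) : Prop := ∃ l, p.getLast? = some l ∧ l.IsElem

/-- `Last(p) ∈ A`. -/
def LastAttr (p : LabelWord) : Prop := ∃ l, p.getLast? = some l ∧ l.IsAttr

/-- `Parnt(p)`. -/
def parnt (p : LabelWord) : LabelWord := p.dropLast

/-- `p ∩ q`, the maximal common prefix. -/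
def pathInter : LabelWord → LabelWord → LabelWord
  | a :: p, b :: q => if a = b then a :: pathInter p q else []
  | [], _ => []
  | _ :: _, [] => []

/-- `pathInter p q` is the greatest common prefix of `p` and `q`. -/
theorem prefix_pathInter_iff (r p q : LabelWord) :
    r <+: pathInter p q ↔ r <+: p ∧ r <+: q := by
  induction p generalizing r q with
  | nil =>
    simp only [pathInter, List.prefix_nil]
    exact ⟨fun h => ⟨h, h ▸ List.nil_prefix⟩, fun h => h.1⟩
  | cons a p ih =>
    cases q with
    | nil =>
      simp only [pathInter, List.prefix_nil]
      exact ⟨fun h => ⟨h ▸ List.nil_prefix, h⟩, fun h => h.2⟩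
    | cons b q =>
      cases r with
      | nil => simp
      | cons c r =>
        by_cases hab : a = b
        · subst hab
          simp only [pathInter, if_true, List.cons_prefix_cons, ih]
          tauto
        · simp only [pathInter, if_neg hab, List.cons_prefix_cons, List.prefix_nil]
          constructor
          · intro h
            cases h
          · rintro ⟨⟨h1, _⟩, ⟨h2, _⟩⟩
            exact absurd (h1.symm.trans h2) hab

/-- The paths occurring in a set `P` of paths: the nonempty prefixes of its members. -/
def pathsOf (P : Set LabelWord) : Set LabelWord := {p | p ≠ [] ∧ ∃ r ∈ P, p <+: r}

/-- An extended XML tree: a finite tree some of whose nodes may be marked nulls `⊥ⱼ`. An XML tree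
is an extended XML tree without nulls (`IsXMLTree` below). -/
structure ExtXMLTree where
  /-- the nodes, nulls included -/
  V : Type
  finite_V : Finite V
  /-- the nodes that are marked nulls -/
  null : Set V
  /-- the distinguished node `v_r` -/
  root : V
  lab : V → Label
  /-- the partial function giving the sequence of subelements -/
  ele : V → Option (List V)
  /-- the partial function giving the attribute with a given name -/
  att : V → ℕ → Option V
  /-- `val v` is a node or a string -/
  val : V → V ⊕ String
  root_not_null : root ∉ null
  lab_root : lab root = rootLabel
  ele_lab : ∀ v l, ele v = some l → (lab v).IsElem
  ele_not_attr : ∀ v l, ele v = some l → ∀ w ∈ l, ¬ (lab w).IsAttr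
  ele_nodup : ∀ v l, ele v = some l → l.Nodup
  att_lab : ∀ v a w, att v a = some w → (lab v).IsElem ∧ lab w = Label.attr a
  /-- element nodes are compared by identity; `val ⊥ⱼ = ⊥ⱼ` -/
  val_node : ∀ v, (lab v).IsElem ∨ v ∈ null → val v = Sum.inl v
  /-- attribute and text nodes carry strings -/
  val_string : ∀ v, ¬ (lab v).IsElem → v ∉ null → ∃ s, val v = Sum.inr s
  /-- nothing is a parent of the root -/
  root_no_parent : ∀ v, ¬ ((∃ l, ele v = some l ∧ root ∈ l) ∨ ∃ a, att v a = some root)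
  /-- every node has at most one parent -/
  parent_unique : ∀ u v w, ((∃ l, ele u = some l ∧ w ∈ l) ∨ ∃ a, att u a = some w) →
    ((∃ l, ele v = some l ∧ w ∈ l) ∨ ∃ a, att v a = some w) → u = v
  /-- every node is reached from the root -/
  reachable : ∀ v, Relation.ReflTransGen
    (fun u w => (∃ l, ele u = some l ∧ w ∈ l) ∨ ∃ a, att u a = some w) root v

namespace ExtXMLTree

variable (T : ExtXMLTree)

/-- `T` is an XML tree: it has no nulls. -/
def IsXMLTree : Prop := T.null = ∅

/-- `T.Child u w`: the node `w` is a child (subelement or attribute) of the node `u`. -/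
def Child (u w : T.V) : Prop :=
  (∃ l, T.ele u = some l ∧ w ∈ l) ∨ ∃ a, T.att u a = some w

/-- `vs ∈ Paths(p)`: `vs` is a path instance defined over `p`. -/
def IsInstance (p : LabelWord) (vs : List T.V) : Prop :=
  vs.head? = some T.root ∧ vs.IsChain T.Child ∧ vs.map T.lab = p

/-- `N(p)`, the set of final nodes of the path instances over `p`. -/
def N (p : LabelWord) : Set T.V := {v | ∃ vs, T.IsInstance p vs ∧ vs.getLast? = some v}

/-- `AAncestor(v, p)`, the nodes on the path instances over `p` that end in `v`. -/
def AAncestor (v : T.V) (p : LabelWord) : Set T.V :=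
  {u | ∃ vs, T.IsInstance p vs ∧ vs.getLast? = some v ∧ u ∈ vs}

/-- `Nodes(v, p)`, the final nodes of path instances over `p` that lie below `v`. -/
def Nodes (v : T.V) (p : LabelWord) : Set T.V := {x | x ∈ T.N p ∧ v ∈ T.AAncestor x p}

/-- `(T, P)` is consistent. -/
def IsConsistent (P : Set LabelWord) : Prop :=
  (∀ p ∈ P, ∀ q ∈ P, ∀ (i : ℕ) (l : Label), p[i]? = some l → q.getLast? = some l →
    p.take (i + 1) = q) ∧
  (∀ u w, T.Child u w → ∃ p ∈ P, ∃ i j : ℕ, i < j ∧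
    p[i]? = some (T.lab u) ∧ p[j]? = some (T.lab w))

/-- `T` is an XML tree that is complete w.r.t. `P`: `(T, P)` is consistent and `T` is its own
minimal extension `T_P`, i.e. every node `v` whose label appears in a path `p ∈ P` already lies
on a path instance over `p`, so that no null has to be added. -/
def IsComplete (P : Set LabelWord) : Prop :=
  T.IsXMLTree ∧ T.IsConsistent P ∧
  ∀ p ∈ P, ∀ v, T.lab v ∈ p → ∃ vs, T.IsInstance p vs ∧ v ∈ vs

end ExtXMLTree

/-- An XFD `p₁, …, pₖ → q`. -/
structure XFD where
  lhs : List LabelWord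
  rhs : LabelWord

/-- The unary XFD `p → q`. -/
def XFD.unary (p q : LabelWord) : XFD := ⟨[p], q⟩

/-- Strong satisfaction of the XFD `p₁, …, pₖ → q`, evaluated in an extended tree that is its own
minimal extension. Here `x` (resp. `y`) is the unique node of the instance `vs` (resp. `ws`) of `q`
that belongs to `N(pᵢ ∩ q)`. -/
def ExtXMLTree.Satisfies (T : ExtXMLTree) (σ : XFD) : Prop :=
  σ.rhs ∈ σ.lhs ∨
  ∀ vs ws v w, T.IsInstance σ.rhs vs → T.IsInstance σ.rhs ws → vs ≠ ws →
    vs.getLast? = some v → ws.getLast? = some w →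
    (v ∈ T.null ∨ w ∈ T.null ∨ T.val v ≠ T.val w) →
    ∃ p ∈ σ.lhs, ∃ x ∈ vs, ∃ y ∈ ws,
      x ∈ T.N (pathInter p σ.rhs) ∧ y ∈ T.N (pathInter p σ.rhs) ∧
      (LastElem p → x ≠ y) ∧
      (¬ LastElem p →
        (∀ u ∈ T.Nodes x p, u ∉ T.null) ∧ (∀ u ∈ T.Nodes y p, u ∉ T.null) ∧
        T.val '' T.Nodes x p ∩ T.val '' T.Nodes y p = ∅)

/-- `Derives Q S σ`: the XFD `σ` is derived from the set `S` of XFDs by the axioms A1 to A8, where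
only XFDs over the set of paths `Q` are used. -/
inductive Derives (Q : Set LabelWord) (S : Set XFD) : XFD → Prop where
  | hyp (σ : XFD) : σ ∈ S → Derives Q S σ
  | A1 (L : List LabelWord) (q : LabelWord) :
      (∀ p ∈ L, p ∈ Q) → q ∈ L → Derives Q S ⟨L, q⟩
  | A2 (L : List LabelWord) (p q : LabelWord) :
      p ∈ Q → Derives Q S ⟨L, q⟩ → Derives Q S ⟨p :: L, q⟩
  | A3 (L : List LabelWord) (q s : LabelWord) :
      Derives Q S ⟨L, q⟩ → Derives Q S ⟨[q], s⟩ → Derives Q S ⟨L, s⟩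
  | A4 (L : List LabelWord) (p q : LabelWord) :
      p ∈ Q → Derives Q S ⟨L, q⟩ → (∀ r ∈ L, pathInter r q = rootPath) →
      Derives Q S ⟨[p], q⟩
  | A5 (p q p' : LabelWord) :
      p' ∈ Q → Derives Q S ⟨[p], q⟩ → pathInter p q <+: p' → (p' <+: p ∨ p' <+: q) →
      Derives Q S ⟨[p'], q⟩
  | A6 (p q : LabelWord) :
      p ∈ Q → q ∈ Q → LastElem p → q <+: p → Derives Q S ⟨[p], q⟩
  | A7 (q : LabelWord) :
      parnt q ∈ Q → q ∈ Q → LastAttr q → Derives Q S ⟨[parnt q], q⟩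
  | A8 (p : LabelWord) : p ∈ Q → Derives Q S ⟨[p], rootPath⟩

/-- `S` implies `σ` on the trees that are complete w.r.t. `P`. -/
def Implies (P : Set LabelWord) (S : Set XFD) (σ : XFD) : Prop :=
  ∀ T : ExtXMLTree, T.IsComplete P → (∀ τ ∈ S, T.Satisfies τ) → T.Satisfies σ

/-!
Only the second part needs a proof: the first is its contrapositive. Let `X` be the set of all
paths `s` for which `p → s` is derivable, and suppose that `q ∉ X`. The counterexample is a tree
made of two copies of the tree of all paths in `pathsOf P`, glued along the *shared* paths, those
all of whose nonempty prefixes lie in `X`. A non-element node in one copy carries the same string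
as its twin exactly when its path lies in `X`; thus the two copies agree at a path precisely when
the path belongs to `X`.

That this is an XML tree uses A6 (an element path in `X` is shared, hence occurs once), A7 (an
attribute of a shared node is shared, so attributes are unique) and A8 (the root is shared). The
given complete tree shows that `pathsOf P` is finite, that paths ending in a non-element label are
maximal, and that two paths of `P` with a common label have the prefix up to that label in common
(`take_prefix_of_mem`); the last fact makes the glued tree complete.

Since `p ∈ X` and `q ∉ X`, the two copies agree at `p` and differ at `q`, so `p → q` fails. If
`r → s` is in `S` and the copies differ at `s`, then by A3 they differ at `r`, and by A5 and A3
they differ at `r ∩ s`, so that `r → s` holds (`twinTree_satisfies`).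
-/

/-! ### Path instances in an arbitrary tree -/

theorem pathInter_ne_nil {r s : LabelWord} (hr : IsPath r) (hs : IsPath s) :
    pathInter r s ≠ [] := by
  cases r with
  | nil => simp [IsPath] at hr
  | cons a r =>
    cases s with
    | nil => simp [IsPath] at hs
    | cons b s =>
      simp only [IsPath, List.head?_cons, Option.some.injEq] at hr hs
      simp [pathInter, hr, hs]

theorem pathInter_prefix_left (r s : LabelWord) : pathInter r s <+: r :=
  ((prefix_pathInter_iff _ r s).1 (List.prefix_refl _)).1

theorem pathInter_prefix_right (r s : LabelWord) : pathInter r s <+: s :=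
  ((prefix_pathInter_iff _ r s).1 (List.prefix_refl _)).2

namespace ExtXMLTree

variable {T : ExtXMLTree}

theorem Child.isElem {u w : T.V} (h : T.Child u w) : (T.lab u).IsElem := by
  rcases h with ⟨l, hl, _⟩ | ⟨a, ha⟩
  · exact T.ele_lab u l hl
  · exact (T.att_lab u a w ha).1

theorem isInstance_singleton : T.IsInstance rootPath [T.root] := by
  simp [IsInstance, rootPath, T.lab_root]

theorem IsInstance.take {p : LabelWord} {vs : List T.V} (h : T.IsInstance p vs) {n : ℕ}
    (hn : n ≠ 0) : T.IsInstance (p.take n) (vs.take n) := by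
  obtain ⟨h1, h2, h3⟩ := h
  refine ⟨?_, h2.take n, ?_⟩
  · rw [List.head?_take, if_neg hn, h1]
  · rw [List.map_take, h3]

theorem IsInstance.of_prefix {p c : LabelWord} {vs : List T.V} (h : T.IsInstance p vs)
    (hc : c <+: p) (hne : c ≠ []) :
    ∃ ws x, T.IsInstance c ws ∧ ws.getLast? = some x ∧ ws <+: vs := by
  have h' := h.take (n := c.length) (by simpa using hne)
  rw [← List.prefix_iff_eq_take.1 hc] at h'
  have hws : vs.take c.length ≠ [] := by
    intro h0
    have := h'.1
    simp [h0] at this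
  exact ⟨_, _, h', List.getLast?_eq_some_getLast hws, List.take_prefix _ _⟩

theorem isInstance_concat {p : LabelWord} {vs : List T.V} {u w : T.V} :
    T.IsInstance p (vs ++ [u] ++ [w]) ↔
      ∃ p', p = p' ++ [T.lab w] ∧ T.IsInstance p' (vs ++ [u]) ∧ T.Child u w := by
  constructor
  · rintro ⟨h1, h2, h3⟩
    refine ⟨(vs ++ [u]).map T.lab, ?_, ⟨?_, ?_, rfl⟩, ?_⟩
    · rw [← h3]; simp
    · simpa [List.head?_append] using h1
    · exact (List.isChain_append.1 h2).1
    · exact (List.isChain_append.1 h2).2.2 u (by simp) w (by simp)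
  · rintro ⟨p', rfl, ⟨h1, h2, h3⟩, h⟩
    refine ⟨?_, ?_, ?_⟩
    · simpa [List.head?_append] using h1
    · refine List.isChain_append.2 ⟨h2, by simp, ?_⟩
      intro x hx y hy
      simp at hx hy
      subst hx hy
      exact h
    · rw [List.map_append, h3]; simp

/-- As parents are unique, a node is the end of at most one path instance. -/
theorem IsInstance.unique {p p' : LabelWord} {vs ws : List T.V} {v : T.V}
    (h : T.IsInstance p (vs ++ [v])) (h' : T.IsInstance p' (ws ++ [v])) : vs = ws := by
  induction vs using List.reverseRecOn generalizing p p' ws v with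
  | nil =>
    induction ws using List.reverseRecOn with
    | nil => rfl
    | append_singleton ws u _ =>
      have hv : v = T.root := by simpa using h.1
      obtain ⟨_, _, _, hc⟩ := isInstance_concat.1 h'
      exact absurd hc (hv ▸ T.root_no_parent u)
  | append_singleton vs u ih =>
    obtain ⟨_, _, hi, hc⟩ := isInstance_concat.1 h
    induction ws using List.reverseRecOn with
    | nil =>
      have hv : v = T.root := by simpa using h'.1
      exact absurd hc (hv ▸ T.root_no_parent u)
    | append_singleton ws u' _ =>
      obtain ⟨_, _, hi', hc'⟩ := isInstance_concat.1 h'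
      have := T.parent_unique u u' v hc hc'
      subst this
      rw [ih hi hi']

theorem IsInstance.path_unique {p p' : LabelWord} {vs ws : List T.V} {v : T.V}
    (h : T.IsInstance p vs) (hv : vs.getLast? = some v)
    (h' : T.IsInstance p' ws) (hw : ws.getLast? = some v) : p = p' := by
  obtain ⟨vs, rfl⟩ := List.getLast?_eq_some_iff.1 hv
  obtain ⟨ws, rfl⟩ := List.getLast?_eq_some_iff.1 hw
  have := h.unique h'
  subst this
  exact h.2.2.symm.trans h'.2.2

theorem exists_isInstance (v : T.V) :
    ∃ p vs, T.IsInstance p vs ∧ vs.getLast? = some v := by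
  induction T.reachable v with
  | refl => exact ⟨_, _, isInstance_singleton, rfl⟩
  | @tail u w _ h ih =>
    obtain ⟨p, vs, hi, hl⟩ := ih
    obtain ⟨vs, rfl⟩ := List.getLast?_eq_some_iff.1 hl
    exact ⟨p ++ [T.lab w], vs ++ [u] ++ [w], isInstance_concat.2 ⟨p, rfl, hi, h⟩, by simp⟩

/-! ### Sets of paths admitting a complete tree -/

theorem IsComplete.exists_isInstance_of_mem_pathsOf {P : Set LabelWord}
    (hP : ∀ r ∈ P, IsPath r) (hT : T.IsComplete P) {p : LabelWord} (hp : p ∈ pathsOf P) :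
    ∃ vs v, T.IsInstance p vs ∧ vs.getLast? = some v := by
  obtain ⟨hne, r, hr, hpr⟩ := hp
  obtain ⟨vs, hvs, _⟩ := hT.2.2 r hr T.root (by
    rw [T.lab_root]; exact List.mem_of_mem_head? (hP r hr))
  obtain ⟨ws, x, h, hx, _⟩ := hvs.of_prefix hpr hne
  exact ⟨ws, x, h, hx⟩

theorem IsComplete.finite_pathsOf {P : Set LabelWord}
    (hP : ∀ r ∈ P, IsPath r) (hT : T.IsComplete P) : (pathsOf P).Finite := by
  have := T.finite_V
  choose vs v h hv using fun p : pathsOf P => hT.exists_isInstance_of_mem_pathsOf hP p.2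
  have hinj : Function.Injective v := fun p p' e =>
    Subtype.ext ((h p).path_unique (hv p) (h p') (e ▸ hv p'))
  exact Set.finite_coe_iff.1 (Finite.of_injective v hinj)

/-- Every path is realised in a complete tree, so only its last label can be a non-element. -/
theorem IsComplete.isElem_of_concat_mem {P : Set LabelWord}
    (hP : ∀ r ∈ P, IsPath r) (hT : T.IsComplete P) {p : LabelWord} {l : Label}
    (hne : p ≠ []) (hp : p ++ [l] ∈ pathsOf P) : LastElem p := by
  obtain ⟨vs, w, h, hw⟩ := hT.exists_isInstance_of_mem_pathsOf hP hp
  obtain ⟨vs, rfl⟩ := List.getLast?_eq_some_iff.1 hw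
  induction vs using List.reverseRecOn with
  | nil =>
    have := congrArg List.length h.2.2
    simp at this
    exact absurd this hne
  | append_singleton vs u _ =>
    obtain ⟨p', hp', hi, hc⟩ := isInstance_concat.1 h
    obtain ⟨rfl, -⟩ := List.append_inj' hp' rfl
    refine ⟨T.lab u, ?_, hc.isElem⟩
    rw [← hi.2.2]; simp

/-- If a label of `p ∈ P` also occurs in `p' ∈ P`, then `p` and `p'` coincide up to that label:
a node with this label on an instance over `p` lies on an instance over `p'` as well, and the
nodes above it are determined by it. -/
theorem IsComplete.take_prefix_of_mem {P : Set LabelWord}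
    (hP : ∀ r ∈ P, IsPath r) (hT : T.IsComplete P) {p p' c : LabelWord} {l : Label}
    (hp : p ∈ P) (hp' : p' ∈ P) (hc : c ++ [l] <+: p) (hl : l ∈ p') : c ++ [l] <+: p' := by
  obtain ⟨vs, v, h, hv⟩ := hT.exists_isInstance_of_mem_pathsOf hP
    (p := c ++ [l]) ⟨by simp, p, hp, hc⟩
  have hlab : T.lab v = l := by
    obtain ⟨vs, rfl⟩ := List.getLast?_eq_some_iff.1 hv
    have := h.2.2
    rw [List.map_append] at this
    simpa using (List.append_inj' this rfl).2
  obtain ⟨ws, hi, hmem⟩ := hT.2.2 p' hp' v (hlab ▸ hl)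
  -- Truncated after `v`, both instances end in `v`, so they are over the same path.
  obtain ⟨as, bs, rfl⟩ := List.append_of_mem hmem
  have hi' := hi.take (n := as.length + 1) (by simp)
  have hp : c ++ [l] = p'.take (as.length + 1) :=
    h.path_unique hv hi' (by simp [List.take_append])
  rw [hp]
  exact List.take_prefix _ _

/-! ### Trees from a parent relation -/

section OfRel

variable {V : Type} (lab : V → Label) (R : V → V → Prop)

open Classical in
/-- The children of `v` without attribute label, in an arbitrary order. -/
noncomputable def relEle [Finite V] (v : V) : Option (List V) :=
  if (lab v).IsElem then some (Set.toFinite {w | R v w ∧ ¬ (lab w).IsAttr}).toFinset.toList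
  else none

open Classical in
/-- A child of `v` labelled with the attribute name `a`, if there is one. -/
noncomputable def relAtt (v : V) (a : ℕ) : Option V :=
  if h : ∃ w, R v w ∧ lab w = Label.attr a then some h.choose else none

variable {lab R}

theorem relEle_eq_some [Finite V] {v : V} {l : List V} (h : relEle lab R v = some l) :
    (lab v).IsElem ∧ l = (Set.toFinite {w | R v w ∧ ¬ (lab w).IsAttr}).toFinset.toList := by
  simp only [relEle] at h
  split_ifs at h with h1
  exact ⟨h1, (Option.some.inj h).symm⟩

theorem relAtt_eq_some {v w : V} {a : ℕ} (h : relAtt lab R v a = some w) :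
    R v w ∧ lab w = Label.attr a := by
  simp only [relAtt] at h
  split_ifs at h with h1
  exact Option.some.inj h ▸ h1.choose_spec

theorem rel_child_iff [Finite V] (elem : ∀ u w, R u w → (lab u).IsElem)
    (attr : ∀ u w w', R u w → R u w' → (lab w).IsAttr → lab w = lab w' → w = w') (u w : V) :
    ((∃ l, relEle lab R u = some l ∧ w ∈ l) ∨ ∃ a, relAtt lab R u a = some w) ↔ R u w := by
  constructor
  · rintro (⟨l, hl, hw⟩ | ⟨a, ha⟩)
    · rw [(relEle_eq_some hl).2] at hw
      simp at hw
      exact hw.1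
    · exact (relAtt_eq_some ha).1
  · intro h
    by_cases hw : (lab w).IsAttr
    · obtain ⟨a, ha⟩ := hw
      have hex : ∃ w, R u w ∧ lab w = Label.attr a := ⟨w, h, ha⟩
      refine Or.inr ⟨a, ?_⟩
      simp only [relAtt, dif_pos hex]
      exact congrArg some (attr u _ w hex.choose_spec.1 h ⟨a, hex.choose_spec.2⟩
        (hex.choose_spec.2.trans ha.symm))
    · refine Or.inl ⟨_, if_pos (elem u w h), ?_⟩
      simp [h, hw]

open Classical in
/-- The XML tree with node set `V` in which `R u w` means that `u` is the parent of `w`. Non-element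
nodes carry the strings given by `str`. -/
noncomputable def ofRel [Finite V] (root : V) (lab : V → Label) (R : V → V → Prop)
    (str : V → String) (lab_root : lab root = rootLabel)
    (elem : ∀ u w, R u w → (lab u).IsElem)
    (attr : ∀ u w w', R u w → R u w' → (lab w).IsAttr → lab w = lab w' → w = w')
    (no_parent : ∀ v, ¬ R v root) (unique : ∀ u v w, R u w → R v w → u = v)
    (reach : ∀ v, Relation.ReflTransGen R root v) : ExtXMLTree where
  V := V
  finite_V := inferInstance
  null := ∅
  root := root
  lab := lab
  ele := relEle lab R
  att := relAtt lab R
  val := fun v => if (lab v).IsElem then Sum.inl v else Sum.inr (str v)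
  root_not_null := by simp
  lab_root := lab_root
  ele_lab := fun v l h => (relEle_eq_some h).1
  ele_not_attr := by
    intro v l h w hw
    rw [(relEle_eq_some h).2] at hw
    simp at hw
    exact hw.2
  ele_nodup := by
    intro v l h
    rw [(relEle_eq_some h).2]
    exact Finset.nodup_toList _
  att_lab := fun v a w h => ⟨elem v w (relAtt_eq_some h).1, (relAtt_eq_some h).2⟩
  val_node := by
    intro v h
    simp at h
    exact if_pos h
  val_string := fun v h _ => ⟨str v, if_neg h⟩
  root_no_parent := fun v => by rw [rel_child_iff elem attr]; exact no_parent v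
  parent_unique := fun u v w => by
    rw [rel_child_iff elem attr, rel_child_iff elem attr]; exact unique u v w
  reachable := fun v => by
    simpa only [rel_child_iff elem attr] using reach v

end OfRel

end ExtXMLTree

/-! ### The twin tree -/

/-- The data of the construction: `Q` is the set of all paths, `X` the set of paths at which the
two copies agree. -/
structure TwinData (Q X : Set LabelWord) : Prop where
  finite : Q.Finite
  isPath : ∀ π ∈ Q, IsPath π
  prefix_mem : ∀ π ∈ Q, ∀ π', π' <+: π → π' ≠ [] → π' ∈ Q
  lastElem : ∀ π l, π ≠ [] → π ++ [l] ∈ Q → LastElem π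
  root_mem : rootPath ∈ Q ∧ rootPath ∈ X
  elem_prefix : ∀ π ∈ Q, π ∈ X → LastElem π → ∀ π' ∈ Q, π' <+: π → π' ∈ X
  attr_mem : ∀ π ∈ Q, ∀ l, π ++ [l] ∈ Q → l.IsAttr → π ∈ X → π ++ [l] ∈ X

/-- A path of `Q` is shared if all its nonempty prefixes lie in `X`. -/
def Shared (Q X : Set LabelWord) (π : LabelWord) : Prop := ∀ π' ∈ Q, π' <+: π → π' ∈ X

theorem Shared.mono {Q X : Set LabelWord} {π π' : LabelWord} (h : Shared Q X π)
    (hp : π' <+: π) : Shared Q X π' := fun ρ hρ hl => h ρ hρ (hl.trans hp)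

/-- The nodes of the twin tree: a path and the number of the copy it belongs to. A shared path is
represented by one node only, numbered `false`. -/
def TwinNode (Q X : Set LabelWord) : Type :=
  {n : LabelWord × Bool // n.1 ∈ Q ∧ (n.2 = true → ¬ Shared Q X n.1)}

namespace TwinNode

variable {Q X : Set LabelWord}

/-- The path of a node. -/
def path (v : TwinNode Q X) : LabelWord := v.1.1

/-- The copy to which a node belongs. -/
def copy (v : TwinNode Q X) : Bool := v.1.2

theorem path_mem (v : TwinNode Q X) : v.path ∈ Q := v.2.1

theorem not_shared (v : TwinNode Q X) (h : v.copy = true) : ¬ Shared Q X v.path := v.2.2 h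

theorem ext {v w : TwinNode Q X} (h : v.path = w.path) (h' : v.copy = true ↔ w.copy = true) :
    v = w := Subtype.ext (Prod.ext h (Bool.eq_iff_iff.2 h'))

theorem exists_node {π : LabelWord} {b : Prop} (hπ : π ∈ Q) (hb : b → ¬ Shared Q X π) :
    ∃ v : TwinNode Q X, v.path = π ∧ (v.copy = true ↔ b) := by
  classical
  exact ⟨⟨(π, decide b), hπ, fun h => hb (by simpa using h)⟩, rfl, by simp [copy]⟩

/-- `u` is `w` or an ancestor of `w`: its path is a prefix, and it belongs to the same copy unless
its path is shared. -/
def Above (u w : TwinNode Q X) : Prop :=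
  u.path <+: w.path ∧ (u.copy = true ↔ w.copy = true ∧ ¬ Shared Q X u.path)

/-- `u` is the parent of `w`. -/
def Edge (u w : TwinNode Q X) : Prop := (∃ l, w.path = u.path ++ [l]) ∧ u.Above w

theorem Above.refl (v : TwinNode Q X) : v.Above v :=
  ⟨List.prefix_refl _, fun h => ⟨h, v.not_shared h⟩, fun h => h.1⟩

theorem Above.trans {u v w : TwinNode Q X} (h : u.Above v) (h' : v.Above w) : u.Above w := by
  refine ⟨h.1.trans h'.1, ?_⟩
  rw [h.2, h'.2]
  exact ⟨fun a => ⟨a.1.1, a.2⟩, fun a => ⟨⟨a.1, fun hs => a.2 (hs.mono h.1)⟩, a.2⟩⟩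

theorem Above.unique {u v w : TwinNode Q X} (h : u.Above w) (h' : v.Above w)
    (hp : u.path = v.path) : u = v := ext hp (by rw [h.2, h'.2, hp])

theorem Edge.unique {u v w : TwinNode Q X} (h : u.Edge w) (h' : v.Edge w) : u = v := by
  obtain ⟨⟨l, hl⟩, hu⟩ := h
  obtain ⟨⟨l', hl'⟩, hv⟩ := h'
  exact hu.unique hv (List.append_inj' (hl.symm.trans hl') rfl).1

/-- Below a node of one copy the same copy continues, since paths extending a non-shared path are
not shared. -/
theorem exists_below {x : TwinNode Q X} {π : LabelWord} (hπ : π ∈ Q) (hx : x.path <+: π) :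
    ∃ u : TwinNode Q X, u.path = π ∧ x.Above u := by
  obtain ⟨u, hu, hc⟩ := exists_node (X := X) (b := x.copy = true) hπ
    fun h hs => x.not_shared h (hs.mono hx)
  exact ⟨u, hu, hu ▸ hx, fun h => ⟨hc.2 h, x.not_shared h⟩, fun h => hc.1 h.1⟩

/-- The last label of the path; the default value is never used, as paths are nonempty. -/
def lab (v : TwinNode Q X) : Label := v.path.getLast?.getD rootLabel

theorem lab_of_path_concat {v : TwinNode Q X} {π : LabelWord} {l : Label}
    (h : v.path = π ++ [l]) : v.lab = l := by simp [lab, h]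

end TwinNode

namespace TwinData

open TwinNode

variable {Q X : Set LabelWord} (D : TwinData Q X)

include D

theorem ne_nil {π : LabelWord} (h : π ∈ Q) : π ≠ [] := by
  rintro rfl
  simpa [IsPath] using D.isPath _ h

theorem shared_of_lastElem {π : LabelWord} (hπ : π ∈ Q) (hX : π ∈ X) (h : LastElem π) :
    Shared Q X π := D.elem_prefix π hπ hX h

theorem shared_rootPath : Shared Q X rootPath :=
  D.shared_of_lastElem D.root_mem.1 D.root_mem.2 ⟨_, rfl, 0, rfl⟩

theorem finite_node : Finite (TwinNode Q X) :=
  (Set.Finite.subset (D.finite.prod (Set.toFinite (Set.univ : Set Bool)))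
    fun _ h => ⟨h.1, trivial⟩ :
      {n : LabelWord × Bool | n.1 ∈ Q ∧ (n.2 = true → ¬ Shared Q X n.1)}.Finite)

/-- The root of the twin tree. -/
def rootNode : TwinNode Q X := ⟨(rootPath, false), D.root_mem.1, by simp⟩

theorem lab_eq (v : TwinNode Q X) : v.path.getLast? = some v.lab := by
  rw [List.getLast?_eq_some_getLast (D.ne_nil v.path_mem)]
  simp [lab, List.getLast?_eq_some_getLast (D.ne_nil v.path_mem)]

theorem isElem_lab_iff (v : TwinNode Q X) : v.lab.IsElem ↔ LastElem v.path := by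
  simp [LastElem, D.lab_eq v]

theorem edge_isElem (u w : TwinNode Q X) (h : u.Edge w) : u.lab.IsElem := by
  obtain ⟨⟨l, hl⟩, _⟩ := h
  rw [D.isElem_lab_iff]
  exact D.lastElem _ l (D.ne_nil u.path_mem) (hl ▸ w.path_mem)

/-- A node has at most one attribute of each name, as an attribute of a shared node is shared. -/
theorem edge_attr (u w w' : TwinNode Q X) (h : u.Edge w) (h' : u.Edge w') (ha : w.lab.IsAttr)
    (hl : w.lab = w'.lab) : w = w' := by
  obtain ⟨⟨l, hw⟩, hu⟩ := h
  obtain ⟨⟨l', hw'⟩, hu'⟩ := h'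
  have hll : l = l' := by rwa [lab_of_path_concat hw, lab_of_path_concat hw'] at hl
  subst hll
  rw [lab_of_path_concat hw] at ha
  have hp : w.path = w'.path := hw.trans hw'.symm
  refine ext hp ?_
  by_cases hs : Shared Q X u.path
  · have hsw : Shared Q X w.path := by
      intro π hπ hpre
      rw [hw, List.prefix_concat_iff] at hpre
      rcases hpre with rfl | hpre
      · exact D.attr_mem _ u.path_mem l hπ ha (hs _ u.path_mem (List.prefix_refl _))
      · exact hs π hπ hpre
    exact ⟨fun h => absurd hsw (w.not_shared h), fun h => absurd (hp ▸ hsw) (w'.not_shared h)⟩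
  · have h1 := hu.2
    rw [hu'.2] at h1
    tauto

theorem edge_root (v : TwinNode Q X) : ¬ v.Edge D.rootNode := by
  rintro ⟨⟨l, hl⟩, _⟩
  have h := congrArg List.length hl
  have : v.path = [] := by
    simpa [rootNode, path, rootPath] using h
  exact D.ne_nil v.path_mem this

theorem edge_reach (v : TwinNode Q X) : Relation.ReflTransGen Edge D.rootNode v := by
  generalize hπ : v.path = π
  induction π using List.reverseRecOn generalizing v with
  | nil => exact absurd hπ (D.ne_nil v.path_mem)
  | append_singleton π l ih =>
    by_cases hne : π = []
    · have hr : v.path = rootPath := by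
        have := D.isPath _ v.path_mem
        subst hne
        simpa [hπ, IsPath, rootPath] using this
      have : v = D.rootNode := ext hr
        ⟨fun h => absurd (hr ▸ D.shared_rootPath) (v.not_shared h), fun h => by cases h⟩
      rw [this]
    · have hmem : π ∈ Q := D.prefix_mem _ v.path_mem _ (hπ ▸ List.prefix_append _ _) hne
      obtain ⟨u, hu, hc⟩ := exists_node (b := v.copy = true ∧ ¬ Shared Q X π) hmem (·.2)
      exact (ih u hu).tail ⟨⟨l, hu ▸ hπ⟩, hu ▸ hπ ▸ List.prefix_append _ _, hu ▸ hc⟩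

open Classical in
/-- The tree consisting of two copies of the tree of all paths in `Q`, glued along the shared
paths. The strings of twin nodes agree exactly when their common path lies in `X`. -/
noncomputable def twinTree : ExtXMLTree :=
  haveI := D.finite_node
  ExtXMLTree.ofRel D.rootNode lab Edge
    (fun v => toString (decide (v.copy = true ∧ v.path ∉ X))) rfl D.edge_isElem D.edge_attr
    D.edge_root (fun _ _ _ => Edge.unique) D.edge_reach

theorem child_iff (u w : TwinNode Q X) : D.twinTree.Child u w ↔ u.Edge w :=
  haveI := D.finite_node
  ExtXMLTree.rel_child_iff D.edge_isElem D.edge_attr u w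

theorem isXMLTree : D.twinTree.IsXMLTree := rfl

/-- For element nodes values are compared by identity; an element path in `X` is shared, so a node
with that path is unique. -/
theorem val_eq_iff {v w : TwinNode Q X} (h : v.path = w.path) :
    D.twinTree.val v = D.twinTree.val w ↔ v.path ∈ X ∨ v = w := by
  classical
  have hval : ∀ u : TwinNode Q X, D.twinTree.val u =
      if u.lab.IsElem then Sum.inl u
      else Sum.inr (toString (decide (u.copy = true ∧ u.path ∉ X))) := fun _ => rfl
  have htoString : ∀ b c : Bool, toString b = toString c → b = c := by decide
  have hlab : v.lab = w.lab := by simp [lab, h]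
  rw [hval, hval, ← hlab, ← h]
  by_cases he : v.lab.IsElem
  · rw [if_pos he, if_pos he]
    refine ⟨fun e => Or.inr (Sum.inl.inj e), ?_⟩
    rintro (hX | rfl)
    · have hs := D.shared_of_lastElem v.path_mem hX ((D.isElem_lab_iff v).1 he)
      exact congrArg Sum.inl (ext h
        ⟨fun a => absurd hs (v.not_shared a), fun a => absurd (h ▸ hs) (w.not_shared a)⟩)
    · rfl
  · rw [if_neg he, if_neg he]
    by_cases hX : v.path ∈ X
    · exact iff_of_true (congrArg (fun b : Bool => Sum.inr (toString b))
        (decide_eq_decide.2 (by simp [hX]))) (Or.inl hX)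
    · constructor
      · intro e
        have := htoString _ _ (Sum.inr.inj e)
        simp only [hX, not_false_eq_true, and_true, decide_eq_decide] at this
        exact Or.inr (ext h this)
      · rintro (h' | rfl)
        · exact absurd h' hX
        · rfl

/-! ### Path instances in the twin tree -/

theorem path_of_isInstance {p : LabelWord} {vs : List (TwinNode Q X)} {v : TwinNode Q X}
    (h : D.twinTree.IsInstance p vs) (hv : vs.getLast? = some v) :
    v.path = p ∧ ∀ x ∈ vs, x.Above v := by
  obtain ⟨vs, rfl⟩ := List.getLast?_eq_some_iff.1 hv
  clear hv
  induction vs using List.reverseRecOn generalizing p v with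
  | nil =>
    have hv : v = D.rootNode := Option.some.inj h.1
    subst hv
    refine ⟨h.2.2, fun x hx => ?_⟩
    simp only [List.nil_append, List.mem_singleton] at hx
    exact hx ▸ Above.refl _
  | append_singleton vs u ih =>
    obtain ⟨p', rfl, hi, hc⟩ := ExtXMLTree.isInstance_concat.1 h
    rw [D.child_iff] at hc
    obtain ⟨⟨l, hl⟩, ha⟩ := hc
    obtain ⟨h1, h2⟩ := ih hi
    refine ⟨?_, fun x hx => ?_⟩
    · have : D.twinTree.lab v = l := lab_of_path_concat hl
      rw [this, hl, h1]
    · rcases List.mem_append.1 hx with hx | hx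
      · exact (h2 x hx).trans ha
      · exact List.mem_singleton.1 hx ▸ Above.refl _

theorem exists_isInstance (v : TwinNode Q X) :
    ∃ vs : List (TwinNode Q X), D.twinTree.IsInstance v.path vs ∧ vs.getLast? = some v := by
  obtain ⟨p, vs, h, hv⟩ := ExtXMLTree.exists_isInstance (T := D.twinTree) v
  exact ⟨vs, (D.path_of_isInstance h hv).1 ▸ h, hv⟩

theorem mem_N_iff {p : LabelWord} {v : TwinNode Q X} : v ∈ D.twinTree.N p ↔ v.path = p := by
  constructor
  · rintro ⟨vs, h, hv⟩
    exact (D.path_of_isInstance h hv).1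
  · rintro rfl
    exact D.exists_isInstance v

theorem mem_isInstance_iff {p : LabelWord} {vs : List (TwinNode Q X)} {v x : TwinNode Q X}
    (h : D.twinTree.IsInstance p vs) (hv : vs.getLast? = some v) : x ∈ vs ↔ x.Above v := by
  obtain ⟨hp, ha⟩ := D.path_of_isInstance h hv
  refine ⟨ha x, fun hx => ?_⟩
  obtain ⟨ws, y, hi, hy, hpre⟩ := h.of_prefix (hp ▸ hx.1) (D.ne_nil x.path_mem)
  have hmem : y ∈ vs := hpre.subset (List.mem_of_getLast? hy)
  exact hx.unique (ha y hmem) (D.path_of_isInstance hi hy).1.symm ▸ hmem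

theorem mem_Nodes_iff {p : LabelWord} {u x : TwinNode Q X} :
    u ∈ D.twinTree.Nodes x p ↔ u.path = p ∧ x.Above u := by
  constructor
  · rintro ⟨h, vs, hi, hv, hx⟩
    exact ⟨D.mem_N_iff.1 h, (D.mem_isInstance_iff hi hv).1 hx⟩
  · rintro ⟨rfl, hx⟩
    obtain ⟨vs, hi, hv⟩ := D.exists_isInstance u
    exact ⟨D.mem_N_iff.2 rfl, vs, hi, hv, (D.mem_isInstance_iff hi hv).2 hx⟩

/-! ### Satisfaction and violation of unary XFDs in the twin tree -/

/-- `X` is meant to consist of the consequences of one path; for `r → s` in the given set, `h` is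
then A3, and `hc` is A5 followed by A3. -/
theorem twinTree_satisfies {r s : LabelWord} (hr : r ∈ Q) (hs : s ∈ Q) (h : r ∈ X → s ∈ X)
    (hc : pathInter r s ∈ X → s ∈ X) : D.twinTree.Satisfies (XFD.unary r s) := by
  refine Or.inr fun vs ws v w hi hi' _ hv hw hval => ?_
  obtain ⟨hvp, hva⟩ := D.path_of_isInstance hi hv
  obtain ⟨hwp, hwa⟩ := D.path_of_isInstance hi' hw
  have hpath : v.path = w.path := hvp.trans hwp.symm
  have hval : ¬ (D.twinTree.val v = D.twinTree.val w) := by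
    simpa [show D.twinTree.null = ∅ from rfl] using hval
  rw [D.val_eq_iff hpath, not_or, hvp] at hval
  have hcopy : ¬ (v.copy = true ↔ w.copy = true) := fun e => hval.2 (ext hpath e)
  have hne := pathInter_ne_nil (D.isPath r hr) (D.isPath s hs)
  have hcQ := D.prefix_mem s hs _ (pathInter_prefix_right r s) hne
  -- The copies are not glued at `r ∩ s`, so the ancestors `x` and `y` there are distinct.
  have hcs : ¬ Shared Q X (pathInter r s) := fun h' =>
    hval.1 (hc (h' _ hcQ (List.prefix_refl _)))
  obtain ⟨x, hx, hxc⟩ := exists_node (X := X) (b := v.copy = true) hcQ fun _ => hcs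
  obtain ⟨y, hy, hyc⟩ := exists_node (X := X) (b := w.copy = true) hcQ fun _ => hcs
  have hxy : ¬ (x.copy = true ↔ y.copy = true) := by rwa [hxc, hyc]
  refine ⟨r, List.mem_singleton_self r, x, ?_, y, ?_, D.mem_N_iff.2 hx, D.mem_N_iff.2 hy,
    fun _ e => hxy (by rw [e]), fun _ => ⟨fun _ _ => id, fun _ _ => id, ?_⟩⟩
  · refine (D.mem_isInstance_iff hi hv).2 ⟨?_, ?_⟩
    · rw [hx, hvp]; exact pathInter_prefix_right r s
    · rw [hxc, hx]; tauto
  · refine (D.mem_isInstance_iff hi' hw).2 ⟨?_, ?_⟩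
    · rw [hy, hwp]; exact pathInter_prefix_right r s
    · rw [hyc, hy]; tauto
  -- A common value below `x` and `y` would force `r ∈ X` or a node of both copies.
  · refine Set.eq_empty_iff_forall_notMem.2 ?_
    rintro _ ⟨⟨u, hu, rfl⟩, ⟨u', hu', e⟩⟩
    obtain ⟨hup, hxu⟩ := D.mem_Nodes_iff.1 hu
    obtain ⟨hup', hyu⟩ := D.mem_Nodes_iff.1 hu'
    rcases (D.val_eq_iff (hup'.trans hup.symm)).1 e with hX | rfl
    · exact hval.1 (h (hup' ▸ hX))
    · exact hxy (by rw [hxu.unique hyu (hx.trans hy.symm)])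

theorem not_twinTree_satisfies {p q : LabelWord} (hp : p ∈ Q) (hq : q ∈ Q) (hpX : p ∈ X)
    (hqX : q ∉ X) : ¬ D.twinTree.Satisfies (XFD.unary p q) := by
  have hqs : ¬ Shared Q X q := fun h => hqX (h q hq (List.prefix_refl q))
  obtain ⟨v, hvp, hvc⟩ := exists_node (X := X) (b := True) hq fun _ => hqs
  obtain ⟨w, hwp, hwc⟩ := exists_node (X := X) (b := False) hq fun _ => hqs
  obtain ⟨vs, hi, hv⟩ := D.exists_isInstance v
  obtain ⟨ws, hi', hw⟩ := D.exists_isInstance w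
  have hvw : v ≠ w := by
    rintro rfl
    exact hwc.1 (hvc.2 trivial)
  rintro (h | h)
  · have hqp : q = p := List.mem_singleton.1 h
    exact hqX (hqp ▸ hpX)
  · obtain ⟨r, hr, x, -, y, -, hxN, hyN, he, hn⟩ := h vs ws v w (hvp ▸ hi) (hwp ▸ hi')
      (by
        rintro rfl
        exact hvw (Option.some.inj (hv.symm.trans hw))) hv hw
      (Or.inr (Or.inr (by
        rw [Ne, D.val_eq_iff (hvp.trans hwp.symm), hvp]
        tauto)))
    obtain rfl : r = p := List.mem_singleton.1 hr
    have hx := D.mem_N_iff.1 hxN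
    have hy := D.mem_N_iff.1 hyN
    have hpre : pathInter r q <+: r := pathInter_prefix_left r q
    by_cases hel : LastElem r
    · have hs := (D.shared_of_lastElem hp hpX hel).mono hpre
      exact he hel (ext (hx.trans hy.symm)
        ⟨fun h => absurd (hx ▸ hs) (x.not_shared h), fun h => absurd (hy ▸ hs) (y.not_shared h)⟩)
    · obtain ⟨u, hu, hxu⟩ := exists_below hp (hx ▸ hpre)
      obtain ⟨u', hu', hyu⟩ := exists_below hp (hy ▸ hpre)
      have hval := (D.val_eq_iff (hu.trans hu'.symm)).2 (Or.inl (hu ▸ hpX))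
      have hmem : D.twinTree.val u ∈ D.twinTree.val '' D.twinTree.Nodes x r ∩
          D.twinTree.val '' D.twinTree.Nodes y r :=
        ⟨⟨u, D.mem_Nodes_iff.2 ⟨hu, hxu⟩, rfl⟩, ⟨u', D.mem_Nodes_iff.2 ⟨hu', hyu⟩, hval.symm⟩⟩
      rw [(hn hel).2.2] at hmem
      exact hmem

theorem twinTree_isComplete {P : Set LabelWord} (hQ : Q = pathsOf P)
    (hcons : ∀ p ∈ P, ∀ q ∈ P, ∀ (i : ℕ) (l : Label), p[i]? = some l → q.getLast? = some l →
      p.take (i + 1) = q)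
    (htake : ∀ p ∈ P, ∀ p' ∈ P, ∀ c l, c ++ [l] <+: p → l ∈ p' → c ++ [l] <+: p') :
    D.twinTree.IsComplete P := by
  subst hQ
  refine ⟨D.isXMLTree, ⟨hcons, fun u w h => ?_⟩, fun p hp v hl => ?_⟩
  · change TwinNode (pathsOf P) X at u w
    obtain ⟨⟨l, hl⟩, -⟩ := (D.child_iff u w).1 h
    obtain ⟨-, r, hr, hpre⟩ := w.path_mem
    obtain ⟨π, l', hu⟩ : ∃ π l', u.path = π ++ [l'] :=
      (List.eq_nil_or_concat' u.path).resolve_left (D.ne_nil u.path_mem)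
    refine ⟨r, hr, π.length, π.length + 1, Nat.lt_succ_self _, ?_, ?_⟩
    · obtain ⟨t, rfl⟩ := hpre
      rw [show D.twinTree.lab u = l' from lab_of_path_concat hu, hl, hu]
      simp
    · obtain ⟨t, rfl⟩ := hpre
      rw [show D.twinTree.lab w = l from lab_of_path_concat hl, hl, hu]
      simp
  · change TwinNode (pathsOf P) X at v
    obtain ⟨-, r, hr, hpre⟩ := v.path_mem
    obtain ⟨π, l, hv⟩ : ∃ π l, v.path = π ++ [l] :=
      (List.eq_nil_or_concat' v.path).resolve_left (D.ne_nil v.path_mem)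
    rw [show D.twinTree.lab v = l from lab_of_path_concat hv] at hl
    have hvp : v.path <+: p := hv ▸ htake r hr p hp π l (hv ▸ hpre) hl
    have hpQ : p ∈ pathsOf P := ⟨List.ne_nil_of_mem hl, p, hp, List.prefix_refl p⟩
    obtain ⟨w, rfl, hw⟩ := exists_below hpQ hvp
    obtain ⟨vs, hi, hlast⟩ := D.exists_isInstance w
    exact ⟨vs, hi, (D.mem_isInstance_iff hi hlast).2 hw⟩

end TwinData

/-! ### Completeness -/

/-- The paths determined by `p` satisfy the closure conditions needed for the twin tree. -/
theorem twinData_derives {P : Set LabelWord} (hP : ∀ r ∈ P, IsPath r) {T : ExtXMLTree}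
    (hT : T.IsComplete P) (S : Set XFD) {p : LabelWord} (hp : p ∈ pathsOf P) :
    TwinData (pathsOf P) {s | Derives (pathsOf P) S (XFD.unary p s)} where
  finite := hT.finite_pathsOf hP
  isPath := by
    rintro π ⟨hne, r, hr, t, rfl⟩
    have := hP _ hr
    cases π with
    | nil => exact absurd rfl hne
    | cons a π => simpa [IsPath] using this
  prefix_mem := fun π ⟨_, r, hr, hpre⟩ π' h hne => ⟨hne, r, hr, h.trans hpre⟩
  lastElem := fun π l hne h => hT.isElem_of_concat_mem hP hne h
  root_mem := by
    refine ⟨?_, Derives.A8 p hp⟩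
    obtain ⟨hne, r, hr, hpre⟩ := hp
    obtain ⟨t, rfl⟩ : ∃ t, r = rootLabel :: t := by
      have := hP r hr
      cases r with
      | nil => simp [IsPath] at this
      | cons a t => exact ⟨t, by simpa [IsPath] using this⟩
    exact ⟨by simp [rootPath], _, hr, by simp [rootPath]⟩
  elem_prefix := fun π hπ h he π' hπ' hpre => Derives.A3 _ _ _ h (Derives.A6 π π' hπ hπ' he hpre)
  attr_mem := by
    intro π hπ l hl ha h
    have h7 := Derives.A7 (S := S) (π ++ [l]) (by simpa [parnt] using hπ) hl
      ⟨l, by simp, ha⟩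
    rw [parnt, List.dropLast_concat] at h7
    exact Derives.A3 _ _ _ h h7

theorem mainTheorem1 (P : Set LabelWord) (hP : ∀ r ∈ P, IsPath r)
    (hadm : ∃ T : ExtXMLTree, T.IsComplete P)
    (S : Set XFD)
    (hS : ∀ σ ∈ S, ∃ r ∈ pathsOf P, ∃ s ∈ pathsOf P, σ = XFD.unary r s)
    (p q : LabelWord) (hp : p ∈ pathsOf P) (hq : q ∈ pathsOf P) :
    (Implies P S (XFD.unary p q) → Derives (pathsOf P) S (XFD.unary p q)) ∧
    (¬ Derives (pathsOf P) S (XFD.unary p q) →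
      ∃ T : ExtXMLTree, T.IsComplete P ∧ (∀ σ ∈ S, T.Satisfies σ) ∧
        ¬ T.Satisfies (XFD.unary p q)) := by
  have key : ¬ Derives (pathsOf P) S (XFD.unary p q) →
      ∃ T : ExtXMLTree, T.IsComplete P ∧ (∀ σ ∈ S, T.Satisfies σ) ∧
        ¬ T.Satisfies (XFD.unary p q) := by
    intro hnd
    obtain ⟨T, hT⟩ := hadm
    have D := twinData_derives hP hT S hp
    refine ⟨D.twinTree, D.twinTree_isComplete rfl hT.2.1.1
      (fun r hr r' hr' c l => hT.take_prefix_of_mem hP hr hr'), fun σ hσ => ?_,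
      D.not_twinTree_satisfies hp hq (Derives.A1 [p] p (by simpa using hp) (List.mem_singleton_self p)) hnd⟩
    obtain ⟨r, hr, s, hs, rfl⟩ := hS σ hσ
    have hrs : Derives (pathsOf P) S (XFD.unary r s) := Derives.hyp _ hσ
    have hcQ := D.prefix_mem r hr _ (pathInter_prefix_left r s)
      (pathInter_ne_nil (D.isPath r hr) (D.isPath s hs))
    exact D.twinTree_satisfies hr hs (fun h => Derives.A3 _ _ _ h hrs) fun h =>
      Derives.A3 _ _ _ h
        (Derives.A5 r s _ hcQ hrs (List.prefix_refl _) (Or.inl (pathInter_prefix_left r s)))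
  refine ⟨fun himp => ?_, key⟩
  by_contra hnd
  obtain ⟨T, hT, hTS, hv⟩ := key hnd
  exact hv (himp T hT hTS)
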